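/- Let $d\in\mathbb N$, let $\Omega\subset\mathbb R^d$ be compact, and let $\alpha>0$ and $\beta,K_1,K_2,K_3,K_4$ be real numbers. There is a constant $C_1>0$, depending only on $d,\Omega,\alpha,\beta,K_1,K_2,K_3,K_4$, such that the following holds for every integer $N\ge 2$ and every (Borel) probability measure $\mu$ on $\Omega$. Write $\|f\|_p=\left(\int_\Omega|f|^p\,d\mu\right)^{1/p}$ for $1\le p<\infty$ and $\|f\|_\infty=\sup_{x\in\Omega}|f(x)|$. Let $u_1,\dots,u_N:\Omega\to\mathbb R$ be a system that is orthonormal in $L_2(\Omega,\mu)$, put $X_N=\operatorname{span}(u_1,\dots,u_N)$, and assume A. $|u_i(x)-u_i(y)|\le K_1N^{\beta}\|x-y\|_\infty^{\alpha}$ for all $x,y\in\Omega$ and $1\le i\le N$, where $\|x-y\|_\infty=\max_k|x_k-y_k|$; B. $\|u_i\|_\infty^2\le K_2$ for $1\le i\le N$; C. $\|f\|_\infty\le K_3N^{K_4/p}\|f\|_p$ for all $f\in X_N$ and all $p\in[2,\infty)$. Then there are an integer $m$ with $1\le m\le C_1N(\log N)^{7/2}$ and points $\xi^1,\dots,\xi^m\in\Omega$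 (not necessarily distinct) such that for every $f\in X_N$ $$\frac12\|f\|_1\le\frac1m\sum_{j=1}^m|f(\xi^j)|\le\frac32\|f\|_1 .$$ -/

import Mathlib

open MeasureTheory

namespace Discretization

/-- The norm `‖f‖_p = (∫ |f|^p dμ)^(1/p)`, for a real exponent `1 ≤ p < ∞`. -/
noncomputable def pNorm {X : Type*} [MeasurableSpace X] (μ : Measure X) (p : ℝ) (f : X → ℝ) : ℝ :=
  (∫ x, |f x| ^ p ∂μ) ^ (1 / p)

/-- `u_1, …, u_N` is orthonormal in `L_2(Ω, μ)`. -/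
def IsOrthonormalSystem {d N : ℕ} {Ω : Set (Fin d → ℝ)} (μ : Measure Ω)
    (u : Fin N → Ω → ℝ) : Prop :=
  ∀ i j, ∫ x, u i x * u j x ∂μ = if i = j then 1 else 0

/-- The space `X_N = span (u_1, …, u_N)` of functions on `Ω`. -/
def spanSpace {d N : ℕ} {Ω : Set (Fin d → ℝ)} (u : Fin N → Ω → ℝ) : Submodule ℝ (Ω → ℝ) :=
  Submodule.span ℝ (Set.range u)

/-- Condition A: `|u_i(x) - u_i(y)| ≤ K₁ N^β ‖x - y‖_∞^α` on `Ω`. The norm of `Fin d → ℝ` is the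
maximum norm. -/
def ConditionA {d N : ℕ} {Ω : Set (Fin d → ℝ)} (α β K₁ : ℝ) (u : Fin N → Ω → ℝ) : Prop :=
  ∀ i, ∀ x y : Ω, |u i x - u i y| ≤
    K₁ * (N : ℝ) ^ β * ‖(x : Fin d → ℝ) - (y : Fin d → ℝ)‖ ^ α

/-- Condition B: `‖u_i‖_∞² ≤ K₂`, where `‖·‖_∞` is the supremum over `Ω`. -/
def ConditionB {d N : ℕ} {Ω : Set (Fin d → ℝ)} (K₂ : ℝ) (u : Fin N → Ω → ℝ) : Prop :=
  ∀ i, ∀ x : Ω, |u i x| ^ 2 ≤ K₂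

/-- Condition C: `‖f‖_∞ ≤ K₃ N^(K₄/p) ‖f‖_p` for all `f ∈ X_N` and all `p ∈ [2, ∞)`, where
`‖·‖_∞` is the supremum over `Ω`. -/
def ConditionC {d N : ℕ} {Ω : Set (Fin d → ℝ)} (μ : Measure Ω) (K₃ K₄ : ℝ)
    (u : Fin N → Ω → ℝ) : Prop :=
  ∀ f ∈ spanSpace u, ∀ p : ℝ, 2 ≤ p → ∀ x : Ω, |f x| ≤ K₃ * (N : ℝ) ^ (K₄ / p) * pNorm μ p f

end Discretization

namespace Discretization

/-! Random points work: for `m` independent points with law `μ`, the expected uniform deviation of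
the empirical `L_1` norm on the unit ball of `X_N` is a small multiple of `m` once `m` is of order
`N log N`.

Symmetrization (`integral_ciSup_deviation_le`) replaces the deviation by Rademacher sums of
`|f(ξ_j)|`, and contraction (`sum_signs_ciSup_abs_le`) removes the absolute values. The sum `∑ ε_j
f(ξ_j)` is then linear in `f`. By the reproducing formula it is the pairing of `f` with `∑ ε_j D(·,
ξ_j)`, where `D` is the Dirichlet kernel, so on the `L_1` ball it is at most the sup norm of that
kernel sum (`abs_sum_signs_combination_le`). A supremum over an `N`-dimensional ball thus becomes a
supremum over points of `Ω`.

Condition A lets `Ω` be replaced by a net of size polynomial in `N` (`exists_kernel_net`). For each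
net point `t`, condition B bounds both `|D(t, ·)|` and `∫ D(t, ·)² = D(t, t)` by `KN`, and
exponential moments give the maximal inequality `integral_sum_signs_ciSup_le`.
`exists_points_of_net` combines these estimates. -/

/-- The real sign attached to a boolean. -/
def boolSign (b : Bool) : ℝ := if b then 1 else -1

@[simp] lemma boolSign_true : boolSign true = 1 := rfl

@[simp] lemma boolSign_false : boolSign false = -1 := rfl

@[simp] lemma boolSign_not (b : Bool) : boolSign (!b) = -boolSign b := by cases b <;> simp

@[simp] lemma abs_boolSign (b : Bool) : |boolSign b| = 1 := by cases b <;> simp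

/-! ### Contraction for Rademacher averages -/

section Finite

variable {ι : Type*} [Finite ι]

lemma le_ciSup_of_finite (g : ι → ℝ) (i : ι) : g i ≤ ⨆ k, g k :=
  le_ciSup (Set.finite_range g).bddAbove i

lemma continuous_ciSup_of_finite [Nonempty ι] {X : Type*} [TopologicalSpace X] {g : ι → X → ℝ}
    (hg : ∀ i, Continuous (g i)) : Continuous fun x => ⨆ i, g i x := by
  cases nonempty_fintype ι
  have h : (fun x => ⨆ i, g i x) = fun x => Finset.univ.sup' Finset.univ_nonempty fun i => g i x := by
    funext x
    rw [Finset.sup'_univ_eq_ciSup]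
  rw [h]
  exact Continuous.finset_sup'_apply _ fun i _ => hg i

/-- Contraction for a single sign. For a pair `i`, `k` the increment of `φ` is at most `|a i - a
k|`; since `B i + B k` is symmetric, exchanging `i` and `k` absorbs the sign of `a i - a k`. -/
lemma ciSup_add_ciSup_contraction [Nonempty ι] {φ : ℝ → ℝ}
    (hφ : ∀ x y, |φ x - φ y| ≤ |x - y|) (B a : ι → ℝ) :
    (⨆ i, (B i + φ (a i))) + (⨆ i, (B i - φ (a i))) ≤
      (⨆ i, (B i + a i)) + (⨆ i, (B i - a i)) := by
  have key : ∀ i k, (B i + φ (a i)) + (B k - φ (a k)) ≤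
      (⨆ i, (B i + a i)) + (⨆ i, (B i - a i)) := by
    intro i k
    have h := (le_abs_self _).trans (hφ (a i) (a k))
    rcases abs_cases (a i - a k) with ⟨h', _⟩ | ⟨h', _⟩
    · have h1 := le_ciSup_of_finite (fun i => B i + a i) i
      have h2 := le_ciSup_of_finite (fun i => B i - a i) k
      linarith
    · have h1 := le_ciSup_of_finite (fun i => B i + a i) k
      have h2 := le_ciSup_of_finite (fun i => B i - a i) i
      linarith
  rw [← le_sub_iff_add_le]
  refine ciSup_le fun i => ?_
  rw [le_sub_comm]
  refine ciSup_le fun k => ?_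
  linarith [key i k]

/-- The sum over all sign vectors splits off the first sign. -/
lemma sum_signs_succ {m : ℕ} (G : (Fin (m + 1) → Bool) → ℝ) :
    ∑ ε, G ε = (∑ ε : Fin m → Bool, G (Fin.cons true ε)) +
      ∑ ε : Fin m → Bool, G (Fin.cons false ε) := by
  rw [← (Fin.consEquiv fun _ : Fin (m + 1) => Bool).sum_comp, Fintype.sum_prod_type,
    Fintype.sum_bool]
  rfl

/-- The Ledoux–Talagrand contraction principle for Rademacher averages over a finite set. -/
theorem sum_signs_ciSup_contraction [Nonempty ι] {φ : ℝ → ℝ}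
    (hφ : ∀ x y, |φ x - φ y| ≤ |x - y|) (m : ℕ) : ∀ (A : ι → ℝ) (a : Fin m → ι → ℝ),
    ∑ ε : Fin m → Bool, ⨆ i, (A i + ∑ j, boolSign (ε j) * φ (a j i)) ≤
      ∑ ε : Fin m → Bool, ⨆ i, (A i + ∑ j, boolSign (ε j) * a j i) := by
  induction m with
  | zero => intro A a; simp
  | succ m ih =>
    intro A a
    rw [sum_signs_succ, sum_signs_succ]
    simp only [Fin.sum_univ_succ, Fin.cons_zero, Fin.cons_succ, boolSign_true, boolSign_false,
      ← add_assoc]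
    -- For each value of the first sign, its term is absorbed into the offset `A`; this is why the
    -- induction runs over arbitrary `A`.
    refine (add_le_add (ih _ _) (ih _ _)).trans ?_
    rw [← Finset.sum_add_distrib, ← Finset.sum_add_distrib]
    refine Finset.sum_le_sum fun ε _ => ?_
    have h := ciSup_add_ciSup_contraction hφ
      (fun i => A i + ∑ j, boolSign (ε j) * a j.succ i) (a 0)
    simp only [one_mul, neg_mul, ← sub_eq_add_neg]
    refine le_trans (le_of_eq ?_) (h.trans (le_of_eq ?_)) <;>
    · congr 1 <;> (refine iSup_congr fun i => ?_; ring)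

/-- The contraction principle for absolute values, with absolute values outside. -/
theorem sum_signs_ciSup_abs_le {m : ℕ} (a : Fin m → ι → ℝ) (i₀ : ι) (h₀ : ∀ j, a j i₀ = 0) :
    ∑ ε : Fin m → Bool, ⨆ i, |(∑ j, boolSign (ε j) * |a j i|)| ≤
      2 * ∑ ε : Fin m → Bool, ⨆ i, |∑ j, boolSign (ε j) * a j i| := by
  have : Nonempty ι := ⟨i₀⟩
  set S : (Fin m → Bool) → ℝ := fun ε => ⨆ i, ∑ j, boolSign (ε j) * |a j i| with hS
  have hle : ∀ ε i, ∑ j, boolSign (ε j) * |a j i| ≤ S ε := fun ε i =>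
    le_ciSup_of_finite (fun i => ∑ j, boolSign (ε j) * |a j i|) i
  -- The zero function makes both one-sided suprema nonnegative, so their sum dominates the
  -- two-sided one; flipping all signs exchanges them, whence the factor 2.
  have hS0 : ∀ ε, 0 ≤ S ε := fun ε => by simpa [h₀] using hle ε i₀
  have hneg : ∑ ε : Fin m → Bool, S (fun j => !(ε j)) = ∑ ε, S ε :=
    (Equiv.arrowCongr (Equiv.refl (Fin m)) Equiv.boolNot).sum_comp S
  have h1 : ∑ ε : Fin m → Bool, ⨆ i, |(∑ j, boolSign (ε j) * |a j i|)| ≤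
      ∑ ε : Fin m → Bool, (S ε + S (fun j => !(ε j))) := by
    refine Finset.sum_le_sum fun ε _ => ciSup_le fun i => abs_le.2 ⟨?_, ?_⟩
    · have := hle (fun j => !(ε j)) i
      simp only [boolSign_not, neg_mul, Finset.sum_neg_distrib] at this
      linarith [hS0 ε]
    · linarith [hle ε i, hS0 fun j => !(ε j)]
  have h2 : ∑ ε, S ε ≤ ∑ ε : Fin m → Bool, ⨆ i, |∑ j, boolSign (ε j) * a j i| := by
    have h := sum_signs_ciSup_contraction (φ := fun x => |x|) abs_abs_sub_abs_le m
      (fun _ : ι => 0) a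
    simp only [zero_add] at h
    refine h.trans (Finset.sum_le_sum fun ε _ => ciSup_le fun i => ?_)
    exact (le_abs_self _).trans (le_ciSup_of_finite (fun i => |∑ j, boolSign (ε j) * a j i|) i)
  rw [Finset.sum_add_distrib, hneg] at h1
  linarith

end Finite

/-! ### Exponential moments -/

/-- The exponential moment of a Rademacher sum. -/
lemma sum_signs_exp {m : ℕ} (a : Fin m → ℝ) :
    ∑ ε : Fin m → Bool, Real.exp (∑ j, boolSign (ε j) * a j) = 2 ^ m * ∏ j, Real.cosh (a j) := by
  have h := Finset.prod_univ_sum (fun _ : Fin m => (Finset.univ : Finset Bool))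
    (fun j b => Real.exp (boolSign b * a j))
  simp only [Fintype.piFinset_univ, Fintype.sum_bool, boolSign_true, boolSign_false] at h
  simp only [Real.exp_sum]
  rw [← h, ← Fin.prod_const, ← Finset.prod_mul_distrib]
  refine Finset.prod_congr rfl fun j _ => ?_
  rw [Real.cosh_eq]
  simp only [one_mul, neg_mul]
  ring

lemma cosh_le_one_add_sq {x : ℝ} (hx : |x| ≤ 1) : Real.cosh x ≤ 1 + x ^ 2 := by
  have hx2 : x ^ 2 ≤ 1 := by rw [← sq_abs]; exact pow_le_one₀ (abs_nonneg x) hx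
  have h0 : |x ^ 2 / 2| = x ^ 2 / 2 := abs_of_nonneg (by positivity)
  have h := (le_abs_self _).trans
    (Real.abs_exp_sub_one_le (x := x ^ 2 / 2) (by rw [h0]; linarith))
  rw [h0] at h
  linarith [Real.cosh_le_exp_half_sq x]

lemma integrable_of_continuous {Y : Type*} [TopologicalSpace Y] [CompactSpace Y]
    [MeasurableSpace Y] [OpensMeasurableSpace Y] {μ : Measure Y} [IsFiniteMeasure μ]
    {f : Y → ℝ} (hf : Continuous f) : Integrable f μ :=
  hf.integrable_of_hasCompactSupport (HasCompactSupport.of_compactSpace f)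

/-! ### Symmetrization and a maximal inequality for random samples -/

/-- Exchange of the coordinates of two samples where the sign is negative. -/
def mixSamples {X : Type*} {m : ℕ} (ε : Fin m → Bool) (z : (Fin m → X) × (Fin m → X)) :
    (Fin m → X) × (Fin m → X) :=
  (fun j => if ε j then z.1 j else z.2 j, fun j => if ε j then z.2 j else z.1 j)

/-- Viewed as one sample of `m` pairs, the map acts coordinatewise by the identity or the swap, and
both preserve `μ.prod μ`. -/
lemma measurePreserving_mixSamples {X : Type*} [MeasurableSpace X] (μ : Measure X)
    [IsProbabilityMeasure μ] {m : ℕ} (ε : Fin m → Bool) :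
    MeasurePreserving (mixSamples ε)
      ((Measure.pi fun _ : Fin m => μ).prod (Measure.pi fun _ : Fin m => μ))
      ((Measure.pi fun _ : Fin m => μ).prod (Measure.pi fun _ : Fin m => μ)) := by
  have e := measurePreserving_arrowProdEquivProdArrow X X (Fin m) (fun _ => μ) (fun _ => μ)
  have hflip : ∀ j, MeasurePreserving (if ε j then id else Prod.swap : X × X → X × X)
      (μ.prod μ) (μ.prod μ) := by
    intro j
    split_ifs
    · exact MeasurePreserving.id _
    · exact Measure.measurePreserving_swap
  have hp := measurePreserving_pi (fun _ : Fin m => μ.prod μ) (fun _ : Fin m => μ.prod μ) hflip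
  have h := e.comp (hp.comp (MeasurePreserving.symm _ e))
  convert h using 1
  funext z
  refine Prod.ext ?_ ?_ <;> funext j <;> by_cases hj : ε j <;>
    simp [mixSamples, hj, MeasurableEquiv.arrowProdEquivProdArrow, Equiv.arrowProdEquivProdArrow]

section Sampling

variable {X : Type*} [TopologicalSpace X] [CompactSpace X] [SecondCountableTopology X]
  [MeasurableSpace X] [BorelSpace X] (μ : Measure X) [IsProbabilityMeasure μ]
  {ι : Type*} [Finite ι] [Nonempty ι]

/-- Symmetrization: the deviation of empirical means is controlled by the signed sums. -/
theorem integral_ciSup_deviation_le {h : ι → X → ℝ} (hc : ∀ i, Continuous (h i)) {m : ℕ}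
    (ε : Fin m → Bool) :
    ∫ ξ, ⨆ i, |(∑ j, h i (ξ j)) - m * ∫ x, h i x ∂μ| ∂(Measure.pi fun _ : Fin m => μ) ≤
      2 * ∫ ξ, ⨆ i, |∑ j, boolSign (ε j) * h i (ξ j)| ∂(Measure.pi fun _ : Fin m => μ) := by
  set Q := Measure.pi fun _ : Fin m => μ with hQ
  set W : (Fin m → X) × (Fin m → X) → ℝ :=
    fun z => ⨆ i, |(∑ j, h i (z.1 j)) - ∑ j, h i (z.2 j)| with hW
  set V : (Fin m → X) → ℝ := fun ξ => ⨆ i, |∑ j, boolSign (ε j) * h i (ξ j)| with hV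
  have hWc : Continuous W := continuous_ciSup_of_finite fun i => by
    have := hc i
    fun_prop
  have hVc : Continuous V := continuous_ciSup_of_finite fun i => by
    have := hc i
    fun_prop
  have hZc : Continuous fun ξ : Fin m → X =>
      ⨆ i, |(∑ j, h i (ξ j)) - m * ∫ x, h i x ∂μ| := continuous_ciSup_of_finite fun i => by
    have := hc i
    fun_prop
  have hWi : Integrable W (Q.prod Q) := integrable_of_continuous hWc
  have hmean : ∀ i, ∫ ξ', ∑ j, h i (ξ' j) ∂Q = m * ∫ x, h i x ∂μ := by
    intro i
    rw [integral_finsetSum]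
    · rw [Finset.sum_congr rfl fun j _ => integral_comp_eval (μ := fun _ : Fin m => μ) (i := j)
        (hc i).aestronglyMeasurable]
      simp
    · intro j _
      exact integrable_of_continuous ((hc i).comp (continuous_apply j))
  -- The mean is the expectation over an independent copy `ξ'`, which is then pulled out of the
  -- absolute value and the supremum.
  have h1 : ∫ ξ, ⨆ i, |(∑ j, h i (ξ j)) - m * ∫ x, h i x ∂μ| ∂Q ≤ ∫ ξ, ∫ ξ', W (ξ, ξ') ∂Q ∂Q := by
    refine integral_mono (integrable_of_continuous hZc) hWi.integral_prod_left fun ξ => ?_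
    refine ciSup_le fun i => ?_
    have hci : Continuous fun ξ' : Fin m → X => ∑ j, h i (ξ' j) := by
      have := hc i
      fun_prop
    have heq : (∑ j, h i (ξ j)) - m * ∫ x, h i x ∂μ =
        ∫ ξ', ((∑ j, h i (ξ j)) - ∑ j, h i (ξ' j)) ∂Q := by
      rw [integral_sub (integrable_const _) (integrable_of_continuous hci), hmean]
      simp
    rw [heq]
    refine abs_integral_le_integral_abs.trans ?_
    refine integral_mono (integrable_of_continuous (continuous_const.sub hci).abs)
      (integrable_of_continuous (hWc.comp (Continuous.prodMk_right ξ))) fun ξ' => ?_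
    exact le_ciSup_of_finite (fun i => |(∑ j, h i (ξ j)) - ∑ j, h i (ξ' j)|) i
  have hmp := measurePreserving_mixSamples μ ε
  have h2 : ∫ z, W z ∂(Q.prod Q) = ∫ z, W (mixSamples ε z) ∂(Q.prod Q) := by
    conv_lhs => rw [← hmp.map_eq]
    exact integral_map hmp.measurable.aemeasurable hWc.aestronglyMeasurable
  have hV1 : Integrable (fun z : (Fin m → X) × (Fin m → X) => V z.1) (Q.prod Q) :=
    integrable_of_continuous (hVc.comp continuous_fst)
  have hV2 : Integrable (fun z : (Fin m → X) × (Fin m → X) => V z.2) (Q.prod Q) :=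
    integrable_of_continuous (hVc.comp continuous_snd)
  have h3 : ∫ z, W (mixSamples ε z) ∂(Q.prod Q) ≤ ∫ z, (V z.1 + V z.2) ∂(Q.prod Q) := by
    refine integral_mono (hmp.integrable_comp_of_integrable hWi) (hV1.add hV2) fun z => ?_
    refine ciSup_le fun i => ?_
    have heq : (∑ j, h i ((mixSamples ε z).1 j)) - ∑ j, h i ((mixSamples ε z).2 j) =
        (∑ j, boolSign (ε j) * h i (z.1 j)) - ∑ j, boolSign (ε j) * h i (z.2 j) := by
      rw [← Finset.sum_sub_distrib, ← Finset.sum_sub_distrib]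
      refine Finset.sum_congr rfl fun j _ => ?_
      by_cases hj : ε j
      · simp [mixSamples, hj]
      · simp [mixSamples, hj]
        ring
    rw [heq]
    refine (abs_sub _ _).trans (add_le_add ?_ ?_)
    · exact le_ciSup_of_finite (fun i => |∑ j, boolSign (ε j) * h i (z.1 j)|) i
    · exact le_ciSup_of_finite (fun i => |∑ j, boolSign (ε j) * h i (z.2 j)|) i
  have h4 : ∫ z, (V z.1 + V z.2) ∂(Q.prod Q) = 2 * ∫ ξ, V ξ ∂Q := by
    rw [integral_add hV1 hV2, integral_prod _ hV1, integral_prod _ hV2]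
    simp [two_mul]
  rw [← integral_prod W hWi, h2] at h1
  exact h1.trans (h3.trans h4.le)

/-- Symmetrization followed by contraction. -/
theorem integral_ciSup_abs_deviation_le {f : ι → X → ℝ} (hc : ∀ i, Continuous (f i)) (i₀ : ι)
    (h₀ : ∀ x, f i₀ x = 0) (m : ℕ) :
    2 ^ m * ∫ ξ, ⨆ i, |(∑ j, |f i (ξ j)|) - m * ∫ x, |f i x| ∂μ|
        ∂(Measure.pi fun _ : Fin m => μ) ≤
      4 * ∫ ξ, ∑ ε : Fin m → Bool, ⨆ i, |∑ j, boolSign (ε j) * f i (ξ j)|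
        ∂(Measure.pi fun _ : Fin m => μ) := by
  have hVc : ∀ (ε : Fin m → Bool), Continuous fun ξ : Fin m → X =>
      ⨆ i, |∑ j, boolSign (ε j) * f i (ξ j)| := fun ε => continuous_ciSup_of_finite fun i => by
    have := hc i
    fun_prop
  have hVc' : ∀ (ε : Fin m → Bool), Continuous fun ξ : Fin m → X =>
      ⨆ i, |∑ j, boolSign (ε j) * (|f i (ξ j)|)| :=
    fun ε => continuous_ciSup_of_finite fun i => by
      have := hc i
      fun_prop
  -- The deviation does not depend on `ε`, so summing over all sign vectors only produces the factor
  -- `2 ^ m`.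
  have h1 := Finset.sum_le_sum fun (ε : Fin m → Bool) (_ : ε ∈ Finset.univ) =>
    integral_ciSup_deviation_le μ (fun i => (hc i).abs) ε
  rw [← Finset.mul_sum, ← integral_finsetSum _ fun ε _ => integrable_of_continuous (hVc' ε)] at h1
  simp only [Finset.sum_const, Finset.card_univ, Fintype.card_pi, Fintype.card_bool,
    Finset.prod_const, Fintype.card_fin, nsmul_eq_mul, Nat.cast_pow, Nat.cast_ofNat] at h1
  refine h1.trans ?_
  have h2 : ∫ ξ, ∑ ε : Fin m → Bool, ⨆ i, |∑ j, boolSign (ε j) * (|f i (ξ j)|)|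
        ∂(Measure.pi fun _ : Fin m => μ) ≤
      ∫ ξ, 2 * ∑ ε : Fin m → Bool, ⨆ i, |∑ j, boolSign (ε j) * f i (ξ j)|
        ∂(Measure.pi fun _ : Fin m => μ) := by
    refine integral_mono
      (integrable_of_continuous (continuous_finsetSum _ fun ε _ => hVc' ε))
      (integrable_of_continuous (continuous_const.mul (continuous_finsetSum _ fun ε _ => hVc ε)))
      fun ξ => ?_
    exact sum_signs_ciSup_abs_le (fun j i => f i (ξ j)) i₀ fun j => h₀ _
  rw [integral_const_mul] at h2
  linarith

/-- A maximal inequality for signed sums over random samples, from exponential moments. -/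
theorem integral_sum_signs_ciSup_le {D : ι → X → ℝ} (hc : ∀ i, Continuous (D i)) {lam s : ℝ}
    (hlam : 0 < lam) (hD : ∀ i x, |lam * D i x| ≤ 1) (hs : ∀ i, ∫ x, D i x ^ 2 ∂μ ≤ s) (m : ℕ) :
    ∫ ξ, ∑ ε : Fin m → Bool, ⨆ i, |∑ j, boolSign (ε j) * D i (ξ j)|
        ∂(Measure.pi fun _ : Fin m => μ) ≤
      2 ^ m * ((Real.log (2 * Nat.card ι) + m * (lam ^ 2 * s) + 1) / lam) := by
  cases nonempty_fintype ι
  set Q := Measure.pi fun _ : Fin m => μ with hQ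
  -- Chosen so that `exp c` equals the bound `2 |ι| exp(m lam² s)` for the total exponential moment.
  set c : ℝ := Real.log (2 * Nat.card ι) + m * (lam ^ 2 * s) with hcdef
  set P : ι → (Fin m → X) → ℝ := fun i ξ => ∏ j, Real.cosh (lam * D i (ξ j)) with hP
  have hPc : ∀ i, Continuous (P i) := fun i => by
    have := hc i
    have := Real.continuous_cosh
    fun_prop
  have hVc : ∀ (ε : Fin m → Bool), Continuous fun ξ : Fin m → X =>
      ⨆ i, |∑ j, boolSign (ε j) * D i (ξ j)| := fun ε => continuous_ciSup_of_finite fun i => by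
    have := hc i
    fun_prop
  -- The tangent bound `t - c + 1 ≤ exp (t - c)` takes the place of Jensen's inequality for the
  -- logarithm; the maximum is then bounded by a sum over `i` and both signs.
  have hpt : ∀ (ε : Fin m → Bool) (ξ : Fin m → X),
      lam * ⨆ i, |∑ j, boolSign (ε j) * D i (ξ j)| ≤
        c + Real.exp (-c) * ∑ i, (Real.exp (∑ j, boolSign (ε j) * (lam * D i (ξ j))) +
          Real.exp (∑ j, boolSign (ε j) * (-(lam * D i (ξ j))))) := by
    intro ε ξ
    obtain ⟨i, hi⟩ := exists_eq_ciSup_of_finite (f := fun i => |∑ j, boolSign (ε j) * D i (ξ j)|)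
    rw [← hi]
    set S := ∑ j, boolSign (ε j) * D i (ξ j) with hS
    have hS1 : ∑ j, boolSign (ε j) * (lam * D i (ξ j)) = lam * S := by
      rw [hS, Finset.mul_sum]
      exact Finset.sum_congr rfl fun j _ => by ring
    have hS2 : ∑ j, boolSign (ε j) * (-(lam * D i (ξ j))) = -(lam * S) := by
      rw [← hS1, ← Finset.sum_neg_distrib]
      exact Finset.sum_congr rfl fun j _ => by ring
    have hsum := Finset.single_le_sum (f := fun i =>
      Real.exp (∑ j, boolSign (ε j) * (lam * D i (ξ j))) +
          Real.exp (∑ j, boolSign (ε j) * (-(lam * D i (ξ j)))))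
      (fun i _ => by positivity) (Finset.mem_univ i)
    simp only [hS1, hS2] at hsum
    have hexp : Real.exp (lam * |S|) ≤ Real.exp (lam * S) + Real.exp (-(lam * S)) := by
      rcases abs_cases S with ⟨h, _⟩ | ⟨h, _⟩
      · rw [h]; linarith [Real.exp_pos (-(lam * S))]
      · rw [h, mul_neg]; linarith [Real.exp_pos (lam * S)]
    have h1 := Real.add_one_le_exp (lam * |S| - c)
    have h2 : Real.exp (lam * |S| - c) = Real.exp (-c) * Real.exp (lam * |S|) := by
      rw [← Real.exp_add]; ring_nf
    have h3 := mul_le_mul_of_nonneg_left (hexp.trans hsum) (Real.exp_pos (-c)).le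
    linarith
  have hsum : ∀ ξ : Fin m → X, lam * ∑ ε : Fin m → Bool, ⨆ i, |∑ j, boolSign (ε j) * D i (ξ j)| ≤
      2 ^ m * (c + Real.exp (-c) * ∑ i, 2 * P i ξ) := by
    intro ξ
    rw [Finset.mul_sum]
    refine (Finset.sum_le_sum fun ε _ => hpt ε ξ).trans (le_of_eq ?_)
    rw [Finset.sum_add_distrib, ← Finset.mul_sum, Finset.sum_comm]
    simp only [Finset.sum_add_distrib, sum_signs_exp, Real.cosh_neg]
    simp only [Finset.sum_const, Finset.card_univ, Fintype.card_pi, Fintype.card_bool,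
      Finset.prod_const, Fintype.card_fin, nsmul_eq_mul, Nat.cast_pow, Nat.cast_ofNat,
      ← Finset.mul_sum]
    simp only [hP]
    ring
  have hPint : ∀ i, ∫ ξ, P i ξ ∂Q ≤ Real.exp (m * (lam ^ 2 * s)) := by
    intro i
    have hci := hc i
    have hcosh := Real.continuous_cosh
    rw [hP, hQ, integral_fintype_prod_eq_pow (fun x => Real.cosh (lam * D i x)), Fintype.card_fin]
    have h0 : 0 ≤ ∫ x, Real.cosh (lam * D i x) ∂μ :=
      integral_nonneg fun x => (Real.cosh_pos _).le
    have h1 : ∫ x, Real.cosh (lam * D i x) ∂μ ≤ 1 + lam ^ 2 * s := by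
      have h : ∫ x, Real.cosh (lam * D i x) ∂μ ≤ ∫ x, (1 + lam ^ 2 * D i x ^ 2) ∂μ := by
        refine integral_mono (integrable_of_continuous (by fun_prop))
          (integrable_of_continuous (by fun_prop)) fun x => ?_
        have := cosh_le_one_add_sq (hD i x)
        simp only
        linarith [mul_pow lam (D i x) 2]
      rw [integral_add (integrable_const _) (integrable_of_continuous (by fun_prop)),
        integral_const_mul] at h
      simp only [integral_const, probReal_univ, smul_eq_mul, mul_one] at h
      have := mul_le_mul_of_nonneg_left (hs i) (sq_nonneg lam)
      linarith
    have h2 : ∫ x, Real.cosh (lam * D i x) ∂μ ≤ Real.exp (lam ^ 2 * s) := by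
      linarith [Real.add_one_le_exp (lam ^ 2 * s)]
    calc _ ≤ Real.exp (lam ^ 2 * s) ^ m := pow_le_pow_left₀ h0 h2 m
      _ = _ := by rw [← Real.exp_nat_mul]
  have hint : lam * ∫ ξ, ∑ ε : Fin m → Bool, ⨆ i, |∑ j, boolSign (ε j) * D i (ξ j)| ∂Q ≤
      2 ^ m * (c + Real.exp (-c) * ∑ i, 2 * ∫ ξ, P i ξ ∂Q) := by
    have h : ∫ ξ, lam * ∑ ε : Fin m → Bool, ⨆ i, |∑ j, boolSign (ε j) * D i (ξ j)| ∂Q ≤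
        ∫ ξ, 2 ^ m * (c + Real.exp (-c) * ∑ i, 2 * P i ξ) ∂Q := integral_mono
      (integrable_of_continuous
        (continuous_const.mul (continuous_finsetSum _ fun ε _ => hVc ε)))
      (integrable_of_continuous (by fun_prop)) hsum
    have hsumP : ∫ ξ, ∑ i, 2 * P i ξ ∂Q = ∑ i, 2 * ∫ ξ, P i ξ ∂Q := by
      rw [integral_finsetSum _ fun i _ => integrable_of_continuous (by fun_prop)]
      simp only [integral_const_mul]
    rw [integral_const_mul, integral_const_mul, integral_add (integrable_const _)
      (integrable_of_continuous (by fun_prop)), integral_const_mul, hsumP] at h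
    simpa only [integral_const, probReal_univ, smul_eq_mul, one_mul] using h
  have hcard : (0 : ℝ) < 2 * Nat.card ι := by
    have : 0 < Nat.card ι := Nat.card_pos
    positivity
  have hlast : Real.exp (-c) * ∑ i, 2 * ∫ ξ, P i ξ ∂Q ≤ 1 := by
    have h : ∑ i, 2 * ∫ ξ, P i ξ ∂Q ≤ ∑ _i : ι, 2 * Real.exp (m * (lam ^ 2 * s)) :=
      Finset.sum_le_sum fun i _ => by linarith [hPint i]
    have h' : ∑ _i : ι, 2 * Real.exp (m * (lam ^ 2 * s)) = Real.exp c := by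
      rw [hcdef, Real.exp_add, Real.exp_log hcard]
      simp [Nat.card_eq_fintype_card]
      ring
    rw [h'] at h
    calc _ ≤ Real.exp (-c) * Real.exp c := mul_le_mul_of_nonneg_left h (Real.exp_pos _).le
      _ = 1 := by rw [← Real.exp_add]; simp
  rw [← mul_div_assoc, le_div_iff₀ hlam, mul_comm]
  exact hint.trans (mul_le_mul_of_nonneg_left (by linarith) (by positivity))

end Sampling

/-! ### Nets in a compact set -/

/-- A bounded set of `ℝ^d` has nets of cardinality `O(δ^(-d))`. -/
theorem exists_net_of_isCompact {d : ℕ} {Ω : Set (Fin d → ℝ)} (hΩ : IsCompact Ω) :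
    ∃ A : ℝ, 1 ≤ A ∧ ∀ δ : ℝ, 0 < δ → δ ≤ 1 → ∃ T : Finset Ω, (T.card : ℝ) ≤ (A / δ) ^ d ∧
      ∀ x : Ω, ∃ t ∈ T, ‖(x : Fin d → ℝ) - (t : Fin d → ℝ)‖ ≤ δ := by
  rcases isEmpty_or_nonempty Ω with hempty | hne
  · exact ⟨1, le_rfl, fun δ hδ _ => ⟨∅, by rw [Finset.card_empty, Nat.cast_zero]; positivity,
      fun x => hempty.elim x⟩⟩
  obtain ⟨R, hR0, hR⟩ := hΩ.isBounded.exists_pos_norm_le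
  -- Each coordinate meets at most `2R/δ + 2 ≤ (2R + 2)/δ` cells of side `δ`, because `δ ≤ 1`.
  refine ⟨2 * R + 2, by linarith, fun δ hδ hδ1 => ?_⟩
  classical
  set g : Ω → Fin d → ℤ := fun x k => ⌊(x : Fin d → ℝ) k / δ⌋ with hg
  set B : Finset (Fin d → ℤ) := Fintype.piFinset fun _ => Finset.Icc ⌊-R / δ⌋ ⌊R / δ⌋ with hB
  -- One representative per cell; for a cell missing `Ω`, `invFun` returns an arbitrary point of
  -- `Ω`, which does no harm.
  refine ⟨B.image (Function.invFun g), ?_, fun x => ⟨Function.invFun g (g x), ?_, ?_⟩⟩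
  · have h1 : ((B.image (Function.invFun g)).card : ℝ) ≤ (B.card : ℝ) :=
      Nat.cast_le.2 Finset.card_image_le
    refine h1.trans ?_
    rw [hB, Fintype.card_piFinset]
    simp only [Finset.prod_const, Finset.card_univ, Fintype.card_fin, Int.card_Icc, Nat.cast_pow]
    refine pow_le_pow_left₀ (by positivity) ?_ d
    have hle : ⌊-R / δ⌋ ≤ ⌊R / δ⌋ := Int.floor_le_floor (by gcongr; linarith)
    have h2 : (((⌊R / δ⌋ + 1 - ⌊-R / δ⌋).toNat : ℤ) : ℝ) = (⌊R / δ⌋ : ℝ) + 1 - ⌊-R / δ⌋ := by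
      rw [Int.toNat_of_nonneg (by omega)]
      push_cast
      ring
    rw [Int.cast_natCast] at h2
    rw [h2]
    have h3 := Int.floor_le (R / δ)
    have h4 := Int.lt_floor_add_one (-R / δ)
    have h5 : (2 * R + 2) / δ = R / δ - -R / δ + 2 / δ := by field_simp; ring
    have h6 : 2 ≤ 2 / δ := by rw [le_div_iff₀ hδ]; linarith
    linarith
  · refine Finset.mem_image_of_mem _ (Fintype.mem_piFinset.2 fun k => ?_)
    have hk := abs_le.1 ((norm_le_pi_norm (x : Fin d → ℝ) k).trans (hR x x.2))
    rw [Finset.mem_Icc]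
    exact ⟨Int.floor_le_floor (by gcongr; exact hk.1), Int.floor_le_floor (by gcongr; exact hk.2)⟩
  · have h : g (Function.invFun g (g x)) = g x := Function.invFun_eq ⟨x, rfl⟩
    rw [pi_norm_le_iff_of_nonneg hδ.le]
    intro k
    have hk := Int.abs_sub_lt_one_of_floor_eq_floor (congrFun h k).symm
    rw [← sub_div, abs_div, abs_of_pos hδ, div_lt_one hδ] at hk
    exact hk.le

lemma continuous_of_conditionA {d N : ℕ} {Ω : Set (Fin d → ℝ)} {α β K : ℝ} (hα : 0 < α)
    {u : Fin N → Ω → ℝ} (hA : ConditionA α β K u) (i : Fin N) : Continuous (u i) := by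
  rw [continuous_iff_continuousAt]
  intro x
  rw [ContinuousAt, tendsto_iff_norm_sub_tendsto_zero]
  have hc : Continuous fun y : Ω =>
      K * (N : ℝ) ^ β * ‖(y : Fin d → ℝ) - (x : Fin d → ℝ)‖ ^ α :=
    continuous_const.mul ((by fun_prop : Continuous fun y : Ω =>
      ‖(y : Fin d → ℝ) - (x : Fin d → ℝ)‖).rpow_const fun _ => Or.inr hα.le)
  refine squeeze_zero (fun _ => norm_nonneg _) (fun y => hA i y x) ?_
  have := hc.tendsto x
  simpa [Real.zero_rpow hα.ne'] using this

/-! ### The reproducing kernel and the `L_1` unit ball -/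

section Kernel

variable {X : Type*} {N : ℕ}

/-- The linear combination of a system with given coefficients. -/
def combination (u : Fin N → X → ℝ) (c : Fin N → ℝ) (x : X) : ℝ := ∑ i, c i * u i x

/-- The Dirichlet (reproducing) kernel of a system. -/
def dirichletKernel (u : Fin N → X → ℝ) (x y : X) : ℝ := combination u (fun i => u i x) y

lemma continuous_combination [TopologicalSpace X] {u : Fin N → X → ℝ}
    (hu : ∀ i, Continuous (u i)) (c : Fin N → ℝ) : Continuous (combination u c) := by
  unfold combination
  fun_prop

lemma combination_sub (u : Fin N → X → ℝ) (c c' : Fin N → ℝ) (x : X) :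
    combination u (c - c') x = combination u c x - combination u c' x := by
  simp [combination, sub_mul, Finset.sum_sub_distrib]

lemma combination_smul (u : Fin N → X → ℝ) (a : ℝ) (c : Fin N → ℝ) (x : X) :
    combination u (a • c) x = a * combination u c x := by
  simp [combination, Finset.mul_sum, mul_assoc]

@[simp] lemma combination_zero (u : Fin N → X → ℝ) (x : X) : combination u 0 x = 0 := by
  simp [combination]

lemma abs_combination_le {u : Fin N → X → ℝ} {K r : ℝ} (hK : ∀ i x, |u i x| ≤ K)
    {c : Fin N → ℝ} (hr : ∀ i, |c i| ≤ r) (x : X) : |combination u c x| ≤ N * (r * K) := by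
  refine (Finset.abs_sum_le_sum_abs _ _).trans ?_
  have h : ∀ i ∈ Finset.univ, |c i * u i x| ≤ r * K := fun i _ => by
    rw [abs_mul]
    exact mul_le_mul (hr i) (hK i x) (abs_nonneg _) ((abs_nonneg _).trans (hr i))
  simpa using Finset.sum_le_card_nsmul _ _ _ h

lemma dirichletKernel_comm (u : Fin N → X → ℝ) (x y : X) :
    dirichletKernel u x y = dirichletKernel u y x := by
  simp only [dirichletKernel, combination, mul_comm]

variable [TopologicalSpace X] [CompactSpace X] [MeasurableSpace X] [BorelSpace X]
  {μ : Measure X} [IsProbabilityMeasure μ] {u : Fin N → X → ℝ}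

lemma integral_combination_mul (hu : ∀ i, Continuous (u i))
    (ho : ∀ i j, ∫ x, u i x * u j x ∂μ = if i = j then 1 else 0) (c : Fin N → ℝ) (j : Fin N) :
    ∫ x, combination u c x * u j x ∂μ = c j := by
  simp only [combination, Finset.sum_mul, mul_assoc]
  rw [integral_finsetSum]
  · simp [integral_const_mul, ho]
  · intro i _
    have := hu i
    have := hu j
    exact integrable_of_continuous (by fun_prop)

lemma integral_combination_mul_combination (hu : ∀ i, Continuous (u i))
    (ho : ∀ i j, ∫ x, u i x * u j x ∂μ = if i = j then 1 else 0) (c c' : Fin N → ℝ) :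
    ∫ x, combination u c x * combination u c' x ∂μ = ∑ j, c j * c' j := by
  conv_lhs => enter [2, x]; rw [combination.eq_def u c' x, Finset.mul_sum]
  rw [integral_finsetSum]
  · refine Finset.sum_congr rfl fun j _ => ?_
    rw [mul_comm (c j), ← integral_combination_mul hu ho c j, ← integral_const_mul]
    exact integral_congr_ae (ae_of_all _ fun x => by ring)
  · intro i _
    have := hu i
    have := continuous_combination hu c
    exact integrable_of_continuous (by fun_prop)

/-- Serves twice: it turns point values into pairings for the duality step, and applied to the
kernel itself it gives the second moment `D(y, y)`. -/
lemma integral_combination_mul_dirichletKernel (hu : ∀ i, Continuous (u i))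
    (ho : ∀ i j, ∫ x, u i x * u j x ∂μ = if i = j then 1 else 0) (c : Fin N → ℝ) (y : X) :
    ∫ x, combination u c x * dirichletKernel u y x ∂μ = combination u c y :=
  integral_combination_mul_combination hu ho c _

/-- A coefficient is the inner product with the bounded function `u j`. Hence the `L_1` ball is
bounded in coefficient space, and a vanishing `L_1` norm forces `c = 0`. -/
lemma abs_coeff_le (hu : ∀ i, Continuous (u i))
    (ho : ∀ i j, ∫ x, u i x * u j x ∂μ = if i = j then 1 else 0) {K : ℝ}
    (hK : ∀ i x, |u i x| ≤ K) (c : Fin N → ℝ) (j : Fin N) :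
    |c j| ≤ K * ∫ x, |combination u c x| ∂μ := by
  have hcc := continuous_combination hu c
  have hj := hu j
  rw [← integral_combination_mul hu ho c j, ← integral_const_mul]
  refine abs_integral_le_integral_abs.trans (integral_mono
    (integrable_of_continuous (by fun_prop)) (integrable_of_continuous (by fun_prop)) fun x => ?_)
  simp only [abs_mul]
  rw [mul_comm]
  exact mul_le_mul_of_nonneg_right (hK j x) (abs_nonneg _)

/-- The unit ball of the `L_1` norm on the span has finite uniform nets. -/
lemma exists_finite_net (hu : ∀ i, Continuous (u i))
    (ho : ∀ i j, ∫ x, u i x * u j x ∂μ = if i = j then 1 else 0) {K : ℝ}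
    (hK : ∀ i x, |u i x| ≤ K) {η : ℝ} (hη : 0 < η) :
    ∃ F : Set (Fin N → ℝ), F.Finite ∧ (∀ c ∈ F, ∫ x, |combination u c x| ∂μ ≤ 1) ∧
      ∀ c, ∫ x, |combination u c x| ∂μ ≤ 1 →
        ∃ c' ∈ F, ∀ x, |combination u c x - combination u c' x| ≤ η := by
  set S : Set (Fin N → ℝ) := {c | ∫ x, |combination u c x| ∂μ ≤ 1} with hS
  set K' := max K 1 with hK'
  have hK0 : 0 < K' := by positivity
  have hKK : ∀ i x, |u i x| ≤ K' := fun i x => (hK i x).trans (le_max_left _ _)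
  have hb : Bornology.IsBounded S := by
    refine (isBounded_iff_forall_norm_le).2 ⟨K', fun c hc => ?_⟩
    rw [pi_norm_le_iff_of_nonneg hK0.le]
    intro j
    exact (abs_coeff_le hu ho hKK c j).trans (mul_le_of_le_one_right hK0.le hc)
  have htb : TotallyBounded S := hb.isCompact_closure.totallyBounded.subset subset_closure
  -- A coefficient error `r` costs at most `N r K'` uniformly; `N + 1` keeps the radius meaningful
  -- for `N = 0`.
  obtain ⟨F, hFS, hF, hcover⟩ := Metric.finite_approx_of_totallyBounded htb
    (η / (K' * (N + 1))) (by positivity)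
  refine ⟨F, hF, fun c hc => hFS hc, fun c hc => ?_⟩
  obtain ⟨c', hc', hd⟩ := Set.mem_iUnion₂.1 (hcover hc)
  refine ⟨c', hc', fun x => ?_⟩
  rw [← combination_sub]
  rw [Metric.mem_ball, dist_eq_norm] at hd
  refine (abs_combination_le hKK (fun i => (norm_le_pi_norm (c - c') i).trans hd.le) x).trans ?_
  have h : (N : ℝ) * (η / (K' * (N + 1)) * K') = η * (N / (N + 1)) := by
    field_simp
  rw [h]
  exact mul_le_of_le_one_right hη.le ((div_le_one (by positivity)).2 (by linarith))

end Kernel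

/-! ### Duality and the choice of the points -/

section Points

variable {X : Type*} [TopologicalSpace X] [CompactSpace X] [MeasurableSpace X] [BorelSpace X]
  {μ : Measure X} [IsProbabilityMeasure μ]
  {N : ℕ} {u : Fin N → X → ℝ}

/-- Duality: a signed sum of point values is bounded by the supremum of the same signed sum of
kernels, and that supremum may be taken over a net. -/
lemma abs_sum_signs_combination_le (hu : ∀ i, Continuous (u i))
    (ho : ∀ i j, ∫ x, u i x * u j x ∂μ = if i = j then 1 else 0) {T : Set X} [Finite T] {η : ℝ}
    (hT : ∀ x, ∃ t ∈ T, ∀ y, |dirichletKernel u x y - dirichletKernel u t y| ≤ η)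
    {c : Fin N → ℝ} (hc : ∫ x, |combination u c x| ∂μ ≤ 1) {m : ℕ} (ε : Fin m → Bool)
    (ξ : Fin m → X) :
    |∑ j, boolSign (ε j) * combination u c (ξ j)| ≤
      (⨆ t : T, |∑ j, boolSign (ε j) * dirichletKernel u t (ξ j)|) + m * η := by
  set B := (⨆ t : T, |∑ j, boolSign (ε j) * dirichletKernel u t (ξ j)|) + m * η with hB
  have hsup : ∀ x, |∑ j, boolSign (ε j) * dirichletKernel u x (ξ j)| ≤ B := by
    intro x
    obtain ⟨t, ht, hxt⟩ := hT x
    have h1 := le_ciSup_of_finite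
      (fun t : T => |∑ j, boolSign (ε j) * dirichletKernel u t (ξ j)|) ⟨t, ht⟩
    have h2 : |∑ j, boolSign (ε j) * (dirichletKernel u x (ξ j) - dirichletKernel u t (ξ j))| ≤
        m * η := by
      refine (Finset.abs_sum_le_sum_abs _ _).trans ?_
      refine (Finset.sum_le_card_nsmul _ _ η fun j _ => ?_).trans (by simp)
      rw [abs_mul, abs_boolSign, one_mul]
      exact hxt _
    have h3 : ∑ j, boolSign (ε j) * dirichletKernel u x (ξ j) =
        (∑ j, boolSign (ε j) * dirichletKernel u t (ξ j)) +
          ∑ j, boolSign (ε j) * (dirichletKernel u x (ξ j) - dirichletKernel u t (ξ j)) := by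
      rw [← Finset.sum_add_distrib]
      exact Finset.sum_congr rfl fun j _ => by ring
    rw [h3]
    exact (abs_add_le _ _).trans (add_le_add h1 h2)
  have hcc := continuous_combination hu c
  have hD : ∀ y, Continuous fun x => dirichletKernel u x y := fun y => by
    simp only [dirichletKernel_comm u _ y]
    exact continuous_combination hu _
  -- The reproducing formula at each `ξ j`; the `L_1`–`L_∞` Hölder bound then finishes.
  have heq : ∑ j, boolSign (ε j) * combination u c (ξ j) =
      ∫ x, combination u c x * ∑ j, boolSign (ε j) * dirichletKernel u x (ξ j) ∂μ := by
    simp only [Finset.mul_sum]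
    rw [integral_finsetSum]
    · refine Finset.sum_congr rfl fun j _ => ?_
      rw [← integral_combination_mul_dirichletKernel hu ho c (ξ j), ← integral_const_mul]
      refine integral_congr_ae (ae_of_all _ fun x => ?_)
      simp only [dirichletKernel_comm u (ξ j) x]
      ring
    · intro j _
      have := hD (ξ j)
      exact integrable_of_continuous (by fun_prop)
  have hX : Nonempty X := μ.nonempty_of_neZero
  have hB0 : 0 ≤ B := (abs_nonneg _).trans (hsup hX.some)
  rw [heq]
  refine abs_integral_le_integral_abs.trans ?_
  have h : ∫ x, |combination u c x * ∑ j, boolSign (ε j) * dirichletKernel u x (ξ j)| ∂μ ≤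
      ∫ x, |combination u c x| * B ∂μ := by
    refine integral_mono (integrable_of_continuous (by fun_prop))
      (integrable_of_continuous (by fun_prop)) fun x => ?_
    simp only [abs_mul]
    exact mul_le_mul_of_nonneg_left (hsup x) (abs_nonneg _)
  rw [integral_mul_const] at h
  exact h.trans (mul_le_of_le_one_left hB0 hc)

variable [SecondCountableTopology X]

/-- The expected uniform deviation of the empirical `L_1` norm over finitely many functions. -/
lemma integral_ciSup_combination_deviation_le (hu : ∀ i, Continuous (u i))
    (ho : ∀ i j, ∫ x, u i x * u j x ∂μ = if i = j then 1 else 0) {K : ℝ}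
    (hB : ∀ i x, |u i x| ^ 2 ≤ K) {T : Set X} [Finite T] [Nonempty T] {η lam : ℝ}
    (hT : ∀ x, ∃ t ∈ T, ∀ y, |dirichletKernel u x y - dirichletKernel u t y| ≤ η)
    (hlam : 0 < lam) (hlamK : lam * (K * N) ≤ 1)
    {ι : Type*} [Finite ι] {c : ι → Fin N → ℝ}
    (hc : ∀ i, ∫ x, |combination u (c i) x| ∂μ ≤ 1) (i₀ : ι) (hi₀ : c i₀ = 0) (m : ℕ) :
    ∫ ξ, ⨆ i, |(∑ j, |combination u (c i) (ξ j)|) - m * ∫ x, |combination u (c i) x| ∂μ|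
        ∂(Measure.pi fun _ : Fin m => μ) ≤
      4 * ((Real.log (2 * Nat.card T) + 1) / lam + m * (lam * (K * N)) + m * η) := by
  have : Nonempty ι := ⟨i₀⟩
  set Q := Measure.pi fun _ : Fin m => μ with hQ
  have hD : ∀ t : T, Continuous (dirichletKernel u (t : X)) := fun t =>
    continuous_combination hu _
  have huu : ∀ i x y, |u i x * u i y| ≤ K := fun i x y => by
    rw [abs_mul]
    nlinarith [hB i x, hB i y, sq_nonneg (|u i x| - |u i y|)]
  have hDK : ∀ x y, |dirichletKernel u x y| ≤ K * N := fun x y => by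
    unfold dirichletKernel combination
    refine (Finset.abs_sum_le_sum_abs _ _).trans
      ((Finset.sum_le_card_nsmul _ _ K fun i _ => huu i x y).trans (le_of_eq ?_))
    simp [mul_comm]
  -- The second moment is `D(t, t) ≤ K N`, of the same order as the sup bound rather than its
  -- square; this keeps `m` linear in `N` up to the logarithm.
  have hmax := integral_sum_signs_ciSup_le μ hD (s := K * N) hlam
    (fun t x => by
      rw [abs_mul, abs_of_pos hlam]
      exact (mul_le_mul_of_nonneg_left (hDK _ _) hlam.le).trans hlamK)
    (fun t => by
      have h : ∫ x, dirichletKernel u t x ^ 2 ∂μ = dirichletKernel u t t := by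
        simp only [sq]
        exact integral_combination_mul_dirichletKernel hu ho _ _
      exact h.trans_le ((le_abs_self _).trans (hDK t t))) m
  have hdev := integral_ciSup_abs_deviation_le μ
    (fun i => continuous_combination hu (c i)) i₀ (by simp [hi₀]) m
  have hfc : ∀ (ε : Fin m → Bool), Continuous fun ξ : Fin m → X =>
      ⨆ i, |∑ j, boolSign (ε j) * combination u (c i) (ξ j)| :=
    fun ε => continuous_ciSup_of_finite fun i => by
      have := continuous_combination hu (c i)
      fun_prop
  have hDc : ∀ (ε : Fin m → Bool), Continuous fun ξ : Fin m → X =>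
      ⨆ t : T, |∑ j, boolSign (ε j) * dirichletKernel u t (ξ j)| :=
    fun ε => continuous_ciSup_of_finite fun t => by
      have := hD t
      fun_prop
  have hdual : ∫ ξ, ∑ ε : Fin m → Bool, ⨆ i, |∑ j, boolSign (ε j) * combination u (c i) (ξ j)| ∂Q ≤
      ∫ ξ, ((∑ ε : Fin m → Bool, ⨆ t : T, |∑ j, boolSign (ε j) * dirichletKernel u t (ξ j)|) +
        2 ^ m * (m * η)) ∂Q := by
    refine integral_mono (integrable_of_continuous (continuous_finsetSum _ fun ε _ => hfc ε))
      (integrable_of_continuous ((continuous_finsetSum _ fun ε _ => hDc ε).add continuous_const))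
      fun ξ => ?_
    refine (Finset.sum_le_sum fun ε _ => ciSup_le fun i =>
      abs_sum_signs_combination_le hu ho hT (hc i) ε ξ).trans (le_of_eq ?_)
    rw [Finset.sum_add_distrib]
    simp
  rw [integral_add (integrable_of_continuous (continuous_finsetSum _ fun ε _ => hDc ε))
    (integrable_const _)] at hdual
  simp only [integral_const, probReal_univ, smul_eq_mul, one_mul] at hdual
  have h2 : (0 : ℝ) < 2 ^ m := by positivity
  have h3 : (Real.log (2 * Nat.card T) + m * (lam ^ 2 * (K * N)) + 1) / lam =
      (Real.log (2 * Nat.card T) + 1) / lam + m * (lam * (K * N)) := by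
    field_simp
    ring
  rw [h3] at hmax
  refine le_of_mul_le_mul_left ?_ h2
  linarith

/-- Equal-weight discretization of the `L_1` norm at a number of points governed by a net for the
kernel. -/
theorem exists_points_of_net (hu : ∀ i, Continuous (u i))
    (ho : ∀ i j, ∫ x, u i x * u j x ∂μ = if i = j then 1 else 0) {K : ℝ} (hK : 1 ≤ K)
    (hN : 1 ≤ N) (hB : ∀ i x, |u i x| ^ 2 ≤ K) {T : Set X} [Finite T] [Nonempty T]
    (hT : ∀ x, ∃ t ∈ T, ∀ y, |dirichletKernel u x y - dirichletKernel u t y| ≤ 1 / 64)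
    {m : ℕ} (hm : 4096 * K * N * (Real.log (2 * Nat.card T) + 1) ≤ m) :
    ∃ ξ : Fin m → X, ∀ c : Fin N → ℝ,
      |(∑ j, |combination u c (ξ j)|) - m * ∫ x, |combination u c x| ∂μ| ≤
        m * (1 / 2 * ∫ x, |combination u c x| ∂μ) := by
  have hN0 : (0 : ℝ) < N := by exact_mod_cast hN
  have hK0 : 0 < K := by linarith
  have hK' : ∀ i x, |u i x| ≤ K := fun i x => by
    nlinarith [hB i x, sq_nonneg (|u i x| - 1), abs_nonneg (u i x)]
  obtain ⟨F, hF, hF1, hnet⟩ := exists_finite_net (μ := μ) hu ho hK' (η := 1 / 16) (by norm_num)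
  -- Zero is added because the contraction step needs a function vanishing at every sample.
  set G : Set (Fin N → ℝ) := insert 0 F with hG
  have : Finite G := (hF.insert 0).to_subtype
  have hG1 : ∀ c : G, ∫ x, |combination u (c : Fin N → ℝ) x| ∂μ ≤ 1 := by
    rintro ⟨c, rfl | hc⟩
    · simp
    · exact hF1 c hc
  -- With this `lam`, and `4096 = 64²` in `hm`, each of the three terms is at most `m / 64`, so the
  -- expectation is at most `3m / 16`. Passing to the whole ball adds `2 · m / 16`, which stays
  -- below `m / 2`.
  have hdev := integral_ciSup_combination_deviation_le (lam := 1 / (64 * K * N)) hu ho hB hT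
    (by positivity) (by field_simp; norm_num) hG1 ⟨0, Set.mem_insert _ _⟩ rfl m
  have hlam : (1 / (64 * K * N)) * (K * N) = 1 / 64 := by field_simp
  have hdiv : (Real.log (2 * Nat.card T) + 1) / (1 / (64 * K * N)) =
      64 * K * N * (Real.log (2 * Nat.card T) + 1) := by field_simp
  rw [hlam, hdiv] at hdev
  have hZ : Continuous fun ξ : Fin m → X => ⨆ c : G, |(∑ j, |combination u (c : Fin N → ℝ) (ξ j)|) -
      m * ∫ x, |combination u (c : Fin N → ℝ) x| ∂μ| := by
    have : Nonempty G := ⟨⟨0, Set.mem_insert _ _⟩⟩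
    refine continuous_ciSup_of_finite fun c => ?_
    have := continuous_combination hu c
    fun_prop
  obtain ⟨ξ, hξ⟩ := exists_le_integral (integrable_of_continuous hZ
    (μ := Measure.pi fun _ : Fin m => μ))
  have hm0 : (0 : ℝ) ≤ m := Nat.cast_nonneg m
  have hF2 : ∀ c ∈ F, |(∑ j, |combination u c (ξ j)|) - m * ∫ x, |combination u c x| ∂μ| ≤
      m * (3 / 16) := by
    intro c hc
    have h := le_ciSup_of_finite (fun c : G => |(∑ j, |combination u (c : Fin N → ℝ) (ξ j)|) -
      m * ∫ x, |combination u (c : Fin N → ℝ) x| ∂μ|) ⟨c, Set.mem_insert_of_mem _ hc⟩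
    simp only at h
    linarith
  have hball : ∀ c : Fin N → ℝ, ∫ x, |combination u c x| ∂μ ≤ 1 →
      |(∑ j, |combination u c (ξ j)|) - m * ∫ x, |combination u c x| ∂μ| ≤ m * (1 / 2) := by
    intro c hc
    obtain ⟨c', hc', hcc⟩ := hnet c hc
    have hcont := continuous_combination hu c
    have hcont' := continuous_combination hu c'
    have hcc' : ∀ x, |(|combination u c x| - |combination u c' x|)| ≤ 1 / 16 := fun x =>
      (abs_abs_sub_abs_le _ _).trans (hcc x)
    have h1 : |(∑ j, |combination u c (ξ j)|) - ∑ j, (|combination u c' (ξ j)|)| ≤ m * (1 / 16) := by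
      rw [← Finset.sum_sub_distrib]
      refine (Finset.abs_sum_le_sum_abs _ _).trans ?_
      exact (Finset.sum_le_card_nsmul _ _ (1 / 16) fun j _ => hcc' _).trans (by simp)
    have h2 : |(∫ x, |combination u c x| ∂μ) - ∫ x, |combination u c' x| ∂μ| ≤ 1 / 16 := by
      rw [← integral_sub (integrable_of_continuous (by fun_prop))
        (integrable_of_continuous (by fun_prop))]
      refine abs_integral_le_integral_abs.trans ?_
      have h := integral_mono (μ := μ) (integrable_of_continuous (by fun_prop))
        (integrable_const (1 / 16)) hcc'
      simpa using h
    have h3 := mul_le_mul_of_nonneg_left h2 hm0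
    rw [← abs_of_nonneg hm0, ← abs_mul, abs_of_nonneg hm0] at h3
    have h4 := hF2 c' hc'
    rw [abs_le] at h1 h3 h4 ⊢
    constructor <;> linarith [h1.1, h1.2, h3.1, h3.2, h4.1, h4.2]
  refine ⟨ξ, fun c => ?_⟩
  set a := ∫ x, |combination u c x| ∂μ with ha
  have ha0 : 0 ≤ a := integral_nonneg fun x => abs_nonneg _
  -- Both sides are homogeneous in `c`, so the unit ball suffices unless the norm vanishes.
  rcases ha0.eq_or_lt with h0 | hpos
  · have hc0 : c = 0 := by
      funext j
      have h := abs_coeff_le hu ho hK' c j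
      rw [← ha, ← h0, mul_zero] at h
      exact abs_nonpos_iff.1 h
    rw [← h0, hc0]
    simp
  · have hscale : ∀ x, |combination u (a⁻¹ • c) x| = a⁻¹ * |combination u c x| := fun x => by
      rw [combination_smul, abs_mul, abs_of_pos (inv_pos.2 hpos)]
    have hint : ∫ x, |combination u (a⁻¹ • c) x| ∂μ = 1 := by
      simp only [hscale]
      rw [integral_const_mul, ← ha, inv_mul_cancel₀ hpos.ne']
    have h := hball (a⁻¹ • c) hint.le
    rw [hint] at h
    simp only [hscale, ← Finset.mul_sum] at h
    have h' := mul_le_mul_of_nonneg_left h ha0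
    rw [← abs_of_nonneg ha0, ← abs_mul, abs_of_nonneg ha0, mul_sub, ← mul_assoc,
      mul_inv_cancel₀ hpos.ne', one_mul, mul_one, mul_comm a] at h'
    linarith

end Points

/-! ### Nets for the kernel -/

lemma abs_dirichletKernel_sub_le {d N : ℕ} {Ω : Set (Fin d → ℝ)} {α β K₁ K : ℝ}
    {u : Fin N → Ω → ℝ} (hA : ConditionA α β K₁ u) (hK : ∀ i x, |u i x| ≤ K) (x t y : Ω) :
    |dirichletKernel u x y - dirichletKernel u t y| ≤
      N * (K₁ * (N : ℝ) ^ β * ‖(x : Fin d → ℝ) - (t : Fin d → ℝ)‖ ^ α * K) := by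
  have h := abs_combination_le hK (c := (fun i => u i x) - fun i => u i t)
    (fun i => hA i x t) y
  rwa [combination_sub] at h

/-- Nets for the kernel of polynomial cardinality. -/
lemma exists_kernel_net {d : ℕ} {Ω : Set (Fin d → ℝ)} (hΩ : IsCompact Ω) [Nonempty Ω]
    {α : ℝ} (β K₁ : ℝ) (hα : 0 < α) {K : ℝ} (hK : 1 ≤ K) :
    ∃ B : ℝ, 0 < B ∧ ∀ N : ℕ, 2 ≤ N → ∀ u : Fin N → Ω → ℝ, ConditionA α β K₁ u →
      (∀ i x, |u i x| ≤ K) → ∃ T : Finset Ω, T.Nonempty ∧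
        Real.log (2 * T.card) + 1 ≤ B * Real.log N ∧
        ∀ x, ∃ t ∈ T, ∀ y, |dirichletKernel u x y - dirichletKernel u t y| ≤ 1 / 64 := by
  obtain ⟨A, hA1, hnet⟩ := exists_net_of_isCompact hΩ
  set L := max K₁ 1 with hL
  set M := 64 * K * L with hM
  set b := |β| + 1 with hb
  have hL1 : 1 ≤ L := le_max_right _ _
  have hM1 : 1 ≤ M := by nlinarith
  have hM0 : 0 < M := by linarith
  have hb0 : 0 ≤ b := by positivity
  have hlog2 : 0 < Real.log 2 := Real.log_pos one_lt_two
  have hlogA : 0 ≤ Real.log A := Real.log_nonneg hA1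
  have hlogM : 0 ≤ Real.log M := Real.log_nonneg hM1
  -- Terms free of `N` are absorbed into `log N` through `log N ≥ log 2`.
  refine ⟨(Real.log 2 + 1 + d * (Real.log A + Real.log M / α)) / Real.log 2 + d * b / α,
    by positivity, fun N hN u hA hu => ?_⟩
  have hN2 : (2 : ℝ) ≤ N := by exact_mod_cast hN
  have hN0 : (0 : ℝ) < N := by linarith
  have hlogN : Real.log 2 ≤ Real.log N := Real.log_le_log two_pos hN2
  have hP1 : 1 ≤ M * (N : ℝ) ^ b :=
    one_le_mul_of_one_le_of_one_le hM1 (Real.one_le_rpow (by linarith) hb0)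
  set P := M * (N : ℝ) ^ b with hP
  have hP0 : 0 < P := by linarith
  -- Solves `δ ^ α = 1 / (64 K L N^b)`, which makes the kernel error at most `1 / 64`. Taking `max
  -- K₁ 1` and `|β|` ensures `P ≥ 1`, hence `δ ≤ 1`, even for negative `K₁` or `β`.
  set δ := P ^ (-(1 / α)) with hδ
  have hδ0 : 0 < δ := Real.rpow_pos_of_pos hP0 _
  have hδ1 : δ ≤ 1 := Real.rpow_le_one_of_one_le_of_nonpos hP1 (by
    have : 0 < 1 / α := by positivity
    linarith)
  have hδα : δ ^ α = P⁻¹ := by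
    rw [hδ, ← Real.rpow_mul hP0.le, neg_mul, one_div_mul_cancel hα.ne', Real.rpow_neg_one]
  obtain ⟨T, hTcard, hT⟩ := hnet δ hδ0 hδ1
  have hTne : T.Nonempty := by
    obtain ⟨t, ht, -⟩ := hT (Classical.arbitrary Ω)
    exact ⟨t, ht⟩
  have hT0 : (0 : ℝ) < T.card := by exact_mod_cast hTne.card_pos
  refine ⟨T, hTne, ?_, fun x => ?_⟩
  · have h1 : Real.log T.card ≤ d * (Real.log A + (Real.log M + b * Real.log N) / α) := by
      refine (Real.log_le_log hT0 hTcard).trans (le_of_eq ?_)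
      rw [Real.log_pow, Real.log_div (by positivity) hδ0.ne', hδ, Real.log_rpow hP0, hP,
        Real.log_mul hM0.ne' (by positivity), Real.log_rpow hN0]
      ring
    have h2 : Real.log 2 + 1 + d * (Real.log A + Real.log M / α) ≤
        (Real.log 2 + 1 + d * (Real.log A + Real.log M / α)) / Real.log 2 * Real.log N := by
      rw [div_mul_eq_mul_div, le_div_iff₀ hlog2]
      exact mul_le_mul_of_nonneg_left hlogN (by positivity)
    rw [Real.log_mul two_ne_zero hT0.ne', add_mul]
    refine le_trans ?_ (add_le_add_left h2 _)
    have h3 : d * (Real.log A + (Real.log M + b * Real.log N) / α) =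
        d * (Real.log A + Real.log M / α) + d * b / α * Real.log N := by ring
    linarith
  · obtain ⟨t, ht, hxt⟩ := hT x
    refine ⟨t, ht, fun y => (abs_dirichletKernel_sub_le hA hu x t y).trans ?_⟩
    have h1 : ‖(x : Fin d → ℝ) - (t : Fin d → ℝ)‖ ^ α ≤ P⁻¹ :=
      (Real.rpow_le_rpow (norm_nonneg _) hxt hα.le).trans hδα.le
    have h2 : N * (N : ℝ) ^ β ≤ (N : ℝ) ^ b := by
      rw [hb, add_comm, Real.rpow_add hN0, Real.rpow_one]
      exact mul_le_mul_of_nonneg_left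
        (Real.rpow_le_rpow_of_exponent_le (by linarith) (le_abs_self β)) hN0.le
    have h3 : K₁ * (N : ℝ) ^ β * ‖(x : Fin d → ℝ) - (t : Fin d → ℝ)‖ ^ α ≤
        L * (N : ℝ) ^ β * P⁻¹ := by
      gcongr
      exact le_max_left _ _
    calc N * (K₁ * (N : ℝ) ^ β * ‖(x : Fin d → ℝ) - (t : Fin d → ℝ)‖ ^ α * K)
        ≤ N * (L * (N : ℝ) ^ β * P⁻¹ * K) := by gcongr
      _ = (L * K * P⁻¹) * (N * (N : ℝ) ^ β) := by ring
      _ ≤ (L * K * P⁻¹) * (N : ℝ) ^ b := mul_le_mul_of_nonneg_left h2 (by positivity)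
      _ = 1 / 64 := by
        rw [hP, hM]
        have : (N : ℝ) ^ b ≠ 0 := by positivity
        field_simp

end Discretization

/-! ### The discretization theorem -/

theorem theorem4p9 (d : ℕ) (Ω : Set (Fin d → ℝ)) (hΩ : IsCompact Ω)
    (α β K₁ K₂ K₃ K₄ : ℝ) (hα : 0 < α) :
    ∃ C : ℝ, 0 < C ∧
      ∀ (N : ℕ), 2 ≤ N →
      ∀ (μ : MeasureTheory.Measure Ω) [MeasureTheory.IsProbabilityMeasure μ] (u : Fin N → Ω → ℝ),
        Discretization.IsOrthonormalSystem μ u →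
        Discretization.ConditionA α β K₁ u →
        Discretization.ConditionB K₂ u →
        Discretization.ConditionC μ K₃ K₄ u →
        ∃ (m : ℕ) (ξ : Fin m → Ω),
          1 ≤ m ∧ (m : ℝ) ≤ C * N * Real.log N ^ (7 / 2 : ℝ) ∧
          ∀ f ∈ Discretization.spanSpace u,
            1 / 2 * Discretization.pNorm μ 1 f ≤ 1 / (m : ℝ) * ∑ j, |f (ξ j)| ∧
            1 / (m : ℝ) * ∑ j, |f (ξ j)| ≤ 3 / 2 * Discretization.pNorm μ 1 f := by
  open Discretization in
  have : CompactSpace Ω := isCompact_iff_compactSpace.1 hΩ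
  rcases isEmpty_or_nonempty Ω with hempty | hne
  · exact ⟨1, one_pos, fun N _ μ _ => (hempty.false (μ.nonempty_of_neZero).some).elim⟩
  set K := max K₂ 1
  have hK : 1 ≤ K := le_max_right _ _
  have hK0 : 0 < K := by linarith
  obtain ⟨B, hB0, hnet⟩ := exists_kernel_net hΩ β K₁ hα hK
  have hlog2 : 0 < Real.log 2 := Real.log_pos one_lt_two
  have hl52 : 0 < Real.log 2 ^ (5 / 2 : ℝ) := Real.rpow_pos_of_pos hlog2 _
  -- Rounding up at most doubles `4096 K N B log N`, a number at least 1; the division by `(log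
  -- 2)^(5/2)` turns the bound in `log N` into one in `(log N)^(7/2)`.
  refine ⟨8192 * K * B / Real.log 2 ^ (5 / 2 : ℝ), by positivity,
    fun N hN μ _ u ho hA hB _ => ?_⟩
  have hN2 : (2 : ℝ) ≤ N := by exact_mod_cast hN
  have hlogN : Real.log 2 ≤ Real.log N := Real.log_le_log two_pos hN2
  have hlogN0 : 0 < Real.log N := hlog2.trans_le hlogN
  have hu : ∀ i, Continuous (u i) := continuous_of_conditionA hα hA
  have huK : ∀ i x, |u i x| ^ 2 ≤ K := fun i x => (hB i x).trans (le_max_left _ _)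
  have huK' : ∀ i x, |u i x| ≤ K := fun i x => by
    nlinarith [huK i x, sq_nonneg (|u i x| - 1), abs_nonneg (u i x)]
  obtain ⟨T, hTne, hTlog, hT⟩ := hnet N hN u hA huK'
  have : Nonempty (T : Set Ω) := hTne.to_subtype
  set m := ⌈4096 * K * N * (B * Real.log N)⌉₊ with hm
  have hcard : (Nat.card (T : Set Ω) : ℝ) = T.card := by simp
  have hT1 : (1 : ℝ) ≤ T.card := by exact_mod_cast hTne.card_pos
  have hBl : 1 ≤ B * Real.log N := by
    have := Real.log_nonneg (x := 2 * T.card) (by linarith)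
    linarith
  have hy1 : 1 ≤ 4096 * K * N * (B * Real.log N) := by
    have h : 1 ≤ K * N := by nlinarith
    nlinarith
  have hmle : 4096 * K * N * (B * Real.log N) ≤ m := Nat.le_ceil _
  have hm1 : (1 : ℝ) ≤ m := hy1.trans hmle
  have hm0 : (0 : ℝ) < m := by linarith
  obtain ⟨ξ, hξ⟩ := exists_points_of_net (μ := μ) (T := (T : Set Ω)) (m := m) hu ho hK
    (by omega) huK (by simpa using hT) (by
      rw [hcard]
      exact (mul_le_mul_of_nonneg_left hTlog (by positivity)).trans hmle)
  refine ⟨m, ξ, by exact_mod_cast hm1, ?_, fun f hf => ?_⟩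
  · have h1 : (m : ℝ) ≤ 8192 * K * B * N * Real.log N := by
      have := Nat.ceil_lt_add_one (a := 4096 * K * N * (B * Real.log N)) (by positivity)
      linarith
    have h2 : Real.log N ^ (7 / 2 : ℝ) = Real.log N ^ (5 / 2 : ℝ) * Real.log N := by
      rw [← Real.rpow_add_one hlogN0.ne']
      norm_num
    have h3 : Real.log 2 ^ (5 / 2 : ℝ) ≤ Real.log N ^ (5 / 2 : ℝ) :=
      Real.rpow_le_rpow hlog2.le hlogN (by norm_num)
    rw [h2, div_mul_eq_mul_div, div_mul_eq_mul_div, le_div_iff₀ hl52]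
    calc (m : ℝ) * Real.log 2 ^ (5 / 2 : ℝ)
        ≤ (8192 * K * B * N * Real.log N) * Real.log N ^ (5 / 2 : ℝ) :=
          mul_le_mul h1 h3 hl52.le (by positivity)
      _ = _ := by ring
  · obtain ⟨c, hc⟩ := (Submodule.mem_span_range_iff_exists_fun ℝ).1 hf
    have hfc : f = combination u c := by
      rw [← hc]
      funext x
      simp [combination]
    have hnorm : pNorm μ 1 f = ∫ x, |combination u c x| ∂μ := by
      simp [pNorm, hfc]
    have h := abs_le.1 (hξ c)
    rw [hnorm, hfc, one_div_mul_eq_div (m : ℝ), le_div_iff₀ hm0, div_le_iff₀ hm0]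
    constructor <;> linarith [h.1, h.2]
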